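/- Let $0<\tau<1$ and put $f(\tau)=\tau(1-\tau)/10>0$. For $c>0$, $d\in\mathbb N$ and unit vectors $\psi_0,\psi_1\in\mathbb C^d$ with $|\langle\psi_0|\psi_1\rangle|=\tau$, consider the following state-comparison game. A pair $(x,y)\in\{0,1\}^2$ is drawn uniformly at random and Bob receives the product state $\psi_x\otimes\psi_y\in\mathbb C^d\otimes\mathbb C^d$. He performs a measurement (POVM) $(E_{=},E_{\neq},E_{?})$ on $\mathbb C^d\otimes\mathbb C^d$, whose outcome is his answer "the two states are equal", "the two states are different" or "don't know". His payoff is $1$ if the answer is correct, $0$ if it is "don't know", and $-c$ if it is wrong. Let $p_{\max}$ be the supremum of Bob's expected payoff over all POVMs, $p_s$ its supremum over separable POVMs (those each of whose elements is a finite sum $\sum_i F_i\otimes G_i$ with $F_i,G_i$ positive semidefinite operators on $\mathbb C^d$), and $p_{\mathrm{LOCC}}$ its supremum over the POVMs that can be implemented on the two registers by finitely many rounds of local quantum operations and classical communication. Then for every $0<\tau<1$ there is a $c>0$, depending only on $\tau$, such that for all $d$ and all unit vectors $\psi_0,\psi_1\in\mathbb C^d$ with $|\langle\psi_0|\psi_1\rangle|=\tau$,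 $$p_s\le p_{\max}-f(\tau),\qquad p_{\mathrm{LOCC}}\le p_{\max}-f(\tau);$$ moreover $p_s\le (1-\tau)-f(\tau)$ and $1-\tau\le p_{\max}$. -/

import Mathlib

open scoped Kronecker ComplexOrder Matrix

noncomputable section

namespace StateComparison

/-- Operators on the bipartite system `ℂ^m ⊗ ℂ^n`, in the product basis. -/
abbrev BiOp (m n : ℕ) : Type := Matrix (Fin m × Fin n) (Fin m × Fin n) ℂ

/-- Bob's answers: "the two states are equal", "they are different", "don't know". -/
inductive Answer
  | same
  | different
  | dontKnow
  deriving DecidableEq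

instance : Fintype Answer where
  elems := {.same, .different, .dontKnow}
  complete := by intro a; cases a <;> decide

/-- A measurement (POVM) on `ℂ^m ⊗ ℂ^n` whose outcomes are Bob's answers. -/
structure IsMeasurement {m n : ℕ} (M : Answer → BiOp m n) : Prop where
  posSemidef : ∀ a, (M a).PosSemidef
  sum_eq_one : ∑ a, M a = 1

/-- A separable operator: a finite sum of tensor products of positive semidefinite operators. -/
def IsSeparableOp {m n : ℕ} (E : BiOp m n) : Prop :=
  ∃ (k : ℕ) (F : Fin k → Matrix (Fin m) (Fin m) ℂ) (G : Fin k → Matrix (Fin n) (Fin n) ℂ),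
    (∀ i, (F i).PosSemidef) ∧ (∀ i, (G i).PosSemidef) ∧ E = ∑ i, F i ⊗ₖ G i

/-- A separable measurement: each of its elements is a separable operator. -/
def IsSeparableMeasurement {m n : ℕ} (M : Answer → BiOp m n) : Prop :=
  IsMeasurement M ∧ ∀ a, IsSeparableOp (M a)

/-- The measurements implemented by local operations and classical communication (finitely many
rounds): either an answer is announced, or one of the two sides applies a local
quantum instrument with Kraus operators `K i` (possibly changing the dimension of its system),
communicates the outcome `i`, and an LOCC measurement depending on `i` follows. -/
inductive IsLOCC : ∀ {m n : ℕ}, (Answer → BiOp m n) → Prop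
  | announce {m n : ℕ} (b : Answer) :
      IsLOCC (fun a => if a = b then (1 : BiOp m n) else 0)
  | left {m m' n k : ℕ} (K : Fin k → Matrix (Fin m') (Fin m) ℂ)
      (hK : ∑ i, (K i)ᴴ * K i = 1) (N : Fin k → Answer → BiOp m' n)
      (hN : ∀ i, IsLOCC (N i)) :
      IsLOCC (fun a => ∑ i, (K i ⊗ₖ (1 : Matrix (Fin n) (Fin n) ℂ))ᴴ * N i a *
        (K i ⊗ₖ (1 : Matrix (Fin n) (Fin n) ℂ)))
  | right {m n n' k : ℕ} (K : Fin k → Matrix (Fin n') (Fin n) ℂ)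
      (hK : ∑ i, (K i)ᴴ * K i = 1) (N : Fin k → Answer → BiOp m n')
      (hN : ∀ i, IsLOCC (N i)) :
      IsLOCC (fun a => ∑ i, ((1 : Matrix (Fin m) (Fin m) ℂ) ⊗ₖ K i)ᴴ * N i a *
        ((1 : Matrix (Fin m) (Fin m) ℂ) ⊗ₖ K i))

/-- The product vector `φ ⊗ χ` in the product basis. -/
def tensorVec {m n : ℕ} (φ : EuclideanSpace ℂ (Fin m)) (χ : EuclideanSpace ℂ (Fin n)) :
    Fin m × Fin n → ℂ :=
  fun p => φ p.1 * χ p.2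

/-- Born's rule: the probability `⟨v| E |v⟩` of the outcome with element `E` in the state `v`. -/
def bornProb {m n : ℕ} (E : BiOp m n) (v : Fin m × Fin n → ℂ) : ℝ :=
  (star v ⬝ᵥ (E *ᵥ v)).re

/-- The payoff for the answer `a` if the two registers hold the states number `x` and `y`:
`1` if it is correct, `0` for "don't know", `-c` if it is wrong. -/
def payoff (c : ℝ) (x y : Fin 2) : Answer → ℝ
  | .same => if x = y then 1 else -c
  | .different => if x = y then -c else 1
  | .dontKnow => 0

/-- The expected payoff of the measurement `M` if the pair of states is uniform among the four
products `ψ x ⊗ ψ y`, `x, y ∈ {0, 1}`. -/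
def expectedPayoff {d : ℕ} (c : ℝ) (ψ : Fin 2 → EuclideanSpace ℂ (Fin d))
    (M : Answer → BiOp d d) : ℝ :=
  ∑ x, ∑ y, (1 / 4 : ℝ) * ∑ a, payoff c x y a * bornProb (M a) (tensorVec (ψ x) (ψ y))

/-- The best expected payoff over all measurements. -/
def maxPayoff {d : ℕ} (c : ℝ) (ψ : Fin 2 → EuclideanSpace ℂ (Fin d)) : ℝ :=
  sSup (expectedPayoff c ψ '' {M | IsMeasurement M})

/-- The supremum of the expected payoffs of separable measurements. -/
def sepPayoff {d : ℕ} (c : ℝ) (ψ : Fin 2 → EuclideanSpace ℂ (Fin d)) : ℝ :=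
  sSup (expectedPayoff c ψ '' {M | IsSeparableMeasurement M})

/-- The supremum of the expected payoffs of LOCC measurements. -/
def loccPayoff {d : ℕ} (c : ℝ) (ψ : Fin 2 → EuclideanSpace ℂ (Fin d)) : ℝ :=
  sSup (expectedPayoff c ψ '' {M | IsLOCC M})

/-- The guaranteed gap `f(τ) = τ (1 - τ) / 10`. -/
def gap (τ : ℝ) : ℝ := τ * (1 - τ) / 10

end StateComparison

end

/-!
Removing phases, let `⟨ψ₀, ψ₁⟩ = τ`. A product vector `φ ⊗ χ` has the amplitudes `αₓ βᵧ` on the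
states `ψₓ ⊗ ψᵧ`, and `(α₀ β₀) (α₁ β₁) = (α₀ β₁) (α₁ β₀)`. Hence it can be orthogonal to the two
states of one kind only if it also misses a state of the other kind: if the penalty `c` is large,
the payoff operator of each answer is, on product vectors, at most `(1 + η) |δ ⊗ δ⟩⟨δ ⊗ δ|` with
`δ = ψ₀ - ψ₁`. Summing over the answers of a separable measurement bounds its payoff by
`(1 + η) ‖δ‖⁴ / 4 = (1 + η) (1 - τ)²`, which is less than `1 - τ` for small `η`. LOCC measurements
are separable.

In contrast, entangled measurements can compare the states without errors: in the frame given by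
`ψ₀ ± ψ₁`, projecting onto superpositions of `e₀ ⊗ e₁` with `e₁ ⊗ e₀` and of `e₀ ⊗ e₀` with
`e₁ ⊗ e₁`, chosen orthogonal to the states of the other kind, succeeds with probability `1 - τ`.
-/

namespace StateComparison

section NormInequalities

theorem norm_sq_le_norm_sub_sq_add_norm_sq {E : Type*} [SeminormedAddCommGroup E] {η : ℝ}
    (hη : 0 < η) (s t : E) : ‖s‖ ^ 2 ≤ (1 + η) * ‖s - t‖ ^ 2 + (1 + η⁻¹) * ‖t‖ ^ 2 := by
  calc ‖s‖ ^ 2 ≤ (‖s - t‖ + ‖t‖) ^ 2 := by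
        gcongr
        simpa only [sub_add_cancel] using norm_add_le (s - t) t
    _ = ‖s - t‖ ^ 2 + 2 * ‖s - t‖ * ‖t‖ + ‖t‖ ^ 2 := add_sq _ _
    _ ≤ ‖s - t‖ ^ 2 + (η * ‖s - t‖ ^ 2 + η⁻¹ * ‖t‖ ^ 2) + ‖t‖ ^ 2 := by
        gcongr
        exact two_mul_le_add_mul_sq hη
    _ = (1 + η) * ‖s - t‖ ^ 2 + (1 + η⁻¹) * ‖t‖ ^ 2 := by ring

variable {E : Type*} [SeminormedAddCommGroup E] [InnerProductSpace ℝ E]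

theorem norm_sq_add_norm_sq_le_of_norm_mul_eq {u v w z : E} (h : ‖u‖ * ‖v‖ = ‖w‖ * ‖z‖) :
    ‖u‖ ^ 2 + ‖v‖ ^ 2 ≤ ‖u + v‖ ^ 2 + (‖w‖ ^ 2 + ‖z‖ ^ 2) := by
  have cauchy_schwarz : -(‖u‖ * ‖v‖) ≤ inner ℝ u v :=
    neg_le_of_abs_le (abs_real_inner_le_norm u v)
  have am_gm : 2 * ‖w‖ * ‖z‖ ≤ ‖w‖ ^ 2 + ‖z‖ ^ 2 := two_mul_le_add_sq _ _
  linarith [norm_add_sq_real u v]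

theorem norm_sq_add_norm_sq_sub_le_of_norm_mul_eq {η : ℝ} (hη : 0 < η) {u v w z : E}
    (h : ‖u‖ * ‖v‖ = ‖w‖ * ‖z‖) :
    ‖u‖ ^ 2 + ‖v‖ ^ 2 - (3 + 2 / η) * (‖w‖ ^ 2 + ‖z‖ ^ 2) ≤
      (1 + η) * ‖u + v - (w + z)‖ ^ 2 := by
  have parallelogram : ‖w + z‖ ^ 2 ≤ 2 * (‖w‖ ^ 2 + ‖z‖ ^ 2) := by
    linarith [parallelogram_law_with_norm ℝ w z, sq_nonneg ‖w - z‖]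
  have scaled : (1 + η⁻¹) * ‖w + z‖ ^ 2 ≤ (1 + η⁻¹) * (2 * (‖w‖ ^ 2 + ‖z‖ ^ 2)) := by gcongr
  rw [div_eq_mul_inv]
  linarith [norm_sq_add_norm_sq_le_of_norm_mul_eq h,
    norm_sq_le_norm_sub_sq_add_norm_sq hη (u + v) (w + z)]

end NormInequalities

section Ketbra

/-- The operator `|v⟩⟨v|`, which is the orthogonal projection onto `v` if `v` is a unit vector. -/
def ketbra {ι : Type*} (v : ι → ℂ) : Matrix ι ι ℂ :=
  Matrix.vecMulVec v (star v)

theorem posSemidef_ketbra {ι : Type*} [Finite ι] (v : ι → ℂ) : (ketbra v).PosSemidef :=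
  Matrix.posSemidef_vecMulVec_self_star v

theorem ketbra_smul {ι : Type*} (r : ℝ) (v : ι → ℂ) :
    ketbra ((r : ℂ) • v) = r ^ 2 • ketbra v := by
  simp only [ketbra, Complex.coe_smul, star_smul, star_trivial, Matrix.smul_vecMulVec,
    Matrix.vecMulVec_smul]
  module

theorem ketbra_add_add_ketbra_sub {ι : Type*} (v w : ι → ℂ) :
    ketbra (v + w) + ketbra (v - w) = (2 : ℝ) • (ketbra v + ketbra w) := by
  simp only [ketbra, star_add, star_sub, Matrix.add_vecMulVec, Matrix.vecMulVec_add,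
    Matrix.sub_vecMulVec, Matrix.vecMulVec_sub]
  module

variable {ι : Type*} [Fintype ι]

theorem star_dotProduct_ketbra_mulVec (w v : ι → ℂ) :
    star v ⬝ᵥ (ketbra w *ᵥ v) = ((‖star w ⬝ᵥ v‖ ^ 2 : ℝ) : ℂ) := by
  rw [ketbra, Matrix.vecMulVec_mulVec, op_smul_eq_smul, dotProduct_smul, smul_eq_mul,
    Matrix.star_dotProduct v w, Complex.star_def, Complex.mul_conj, Complex.normSq_eq_norm_sq]

theorem posSemidef_one_sub_sum_smul_ketbra [DecidableEq ι] {κ : Type*} [Fintype κ]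
    {e : κ → EuclideanSpace ℂ ι} (he : Orthonormal ℂ e) {w : κ → ℝ} (hw : ∀ k, w k ≤ 1) :
    (1 - ∑ k, w k • ketbra (e k).ofLp).PosSemidef := by
  have hermitian : (1 - ∑ k, w k • ketbra (e k).ofLp).IsHermitian := by
    simp only [Matrix.IsHermitian, Matrix.conjTranspose_sub, Matrix.conjTranspose_one,
      Matrix.conjTranspose_sum, Matrix.conjTranspose_smul, star_trivial,
      (posSemidef_ketbra _).isHermitian.eq]
  refine .of_dotProduct_mulVec_nonneg hermitian fun v => ?_
  have bessel : ∑ k, w k * ‖star (e k).ofLp ⬝ᵥ v‖ ^ 2 ≤ ‖WithLp.toLp 2 v‖ ^ 2 :=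
    calc ∑ k, w k * ‖star (e k).ofLp ⬝ᵥ v‖ ^ 2
        ≤ ∑ k, ‖inner ℂ (e k) (WithLp.toLp 2 v)‖ ^ 2 := by
          refine Finset.sum_le_sum fun k _ => ?_
          rw [EuclideanSpace.inner_eq_star_dotProduct, dotProduct_comm]
          exact mul_le_of_le_one_left (sq_nonneg _) (hw k)
      _ ≤ ‖WithLp.toLp 2 v‖ ^ 2 := he.sum_inner_products_le _
  have norm_sq : star v ⬝ᵥ v = ((‖WithLp.toLp 2 v‖ ^ 2 : ℝ) : ℂ) := by
    rw [dotProduct_comm, ← EuclideanSpace.inner_toLp_toLp, inner_self_eq_norm_sq_to_K]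
    norm_cast
  rw [Matrix.sub_mulVec, Matrix.one_mulVec, Matrix.sum_mulVec, dotProduct_sub, dotProduct_sum,
    norm_sq]
  simp only [Matrix.smul_mulVec, dotProduct_smul, star_dotProduct_ketbra_mulVec,
    Complex.real_smul]
  exact_mod_cast sub_nonneg.2 bessel

end Ketbra

section BornRule

variable {m n : ℕ}

theorem bornProb_add (E F : BiOp m n) (v : Fin m × Fin n → ℂ) :
    bornProb (E + F) v = bornProb E v + bornProb F v := by
  simp [bornProb, Matrix.add_mulVec, dotProduct_add]

theorem bornProb_sum {ι : Type*} (s : Finset ι) (E : ι → BiOp m n) (v : Fin m × Fin n → ℂ) :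
    bornProb (∑ i ∈ s, E i) v = ∑ i ∈ s, bornProb (E i) v := by
  simp [bornProb, Matrix.sum_mulVec, dotProduct_sum]

theorem bornProb_smul (r : ℝ) (E : BiOp m n) (v : Fin m × Fin n → ℂ) :
    bornProb (r • E) v = r * bornProb E v := by
  simp [bornProb, Matrix.smul_mulVec, dotProduct_smul]

theorem bornProb_smul_vec (E : BiOp m n) (z : ℂ) (v : Fin m × Fin n → ℂ) :
    bornProb E (z • v) = ‖z‖ ^ 2 * bornProb E v := by
  have star_mul_self : star z * z = ((‖z‖ ^ 2 : ℝ) : ℂ) := by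
    rw [Complex.star_def, ← Complex.normSq_eq_conj_mul_self, Complex.normSq_eq_norm_sq]
  rw [bornProb, Matrix.mulVec_smul, star_smul, smul_dotProduct, dotProduct_smul, smul_smul,
    star_mul_self, smul_eq_mul, Complex.re_ofReal_mul, bornProb]

theorem bornProb_nonneg {E : BiOp m n} (hE : E.PosSemidef) (v : Fin m × Fin n → ℂ) :
    0 ≤ bornProb E v :=
  (Complex.le_def.1 (hE.dotProduct_mulVec_nonneg v)).1

theorem bornProb_ketbra (w v : Fin m × Fin n → ℂ) :
    bornProb (ketbra w) v = ‖star w ⬝ᵥ v‖ ^ 2 := by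
  rw [bornProb, star_dotProduct_ketbra_mulVec, Complex.ofReal_re]

theorem star_tensorVec_dotProduct_tensorVec (φ φ' : EuclideanSpace ℂ (Fin m))
    (χ χ' : EuclideanSpace ℂ (Fin n)) :
    star (tensorVec φ χ) ⬝ᵥ tensorVec φ' χ' = inner ℂ φ φ' * inner ℂ χ χ' := by
  simp only [dotProduct, tensorVec, Pi.star_apply, star_mul', PiLp.inner_apply,
    RCLike.inner_apply, Fintype.sum_prod_type, Finset.sum_mul_sum, Complex.star_def]
  refine Finset.sum_congr rfl fun i _ => Finset.sum_congr rfl fun j _ => ?_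
  ring

theorem bornProb_one_tensorVec (φ : EuclideanSpace ℂ (Fin m)) (χ : EuclideanSpace ℂ (Fin n)) :
    bornProb 1 (tensorVec φ χ) = ‖φ‖ ^ 2 * ‖χ‖ ^ 2 := by
  rw [bornProb, Matrix.one_mulVec, star_tensorVec_dotProduct_tensorVec,
    inner_self_eq_norm_sq_to_K, inner_self_eq_norm_sq_to_K]
  norm_cast

theorem IsMeasurement.sum_bornProb {M : Answer → BiOp m n} (hM : IsMeasurement M)
    (v : Fin m × Fin n → ℂ) : ∑ a, bornProb (M a) v = bornProb 1 v := by
  rw [← bornProb_sum, hM.sum_eq_one]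

theorem orthonormal_tensorVec {ι κ : Type*} {e : ι → EuclideanSpace ℂ (Fin m)}
    {f : κ → EuclideanSpace ℂ (Fin n)} (he : Orthonormal ℂ e) (hf : Orthonormal ℂ f) :
    Orthonormal ℂ fun p : ι × κ => WithLp.toLp 2 (tensorVec (e p.1) (f p.2)) := by
  classical
  rw [orthonormal_iff_ite] at he hf ⊢
  intro p q
  rw [EuclideanSpace.inner_toLp_toLp, dotProduct_comm, star_tensorVec_dotProduct_tensorVec,
    he, hf]
  simp only [Prod.ext_iff, ite_and, ite_mul, one_mul, zero_mul]

theorem ketbra_tensorVec (φ : EuclideanSpace ℂ (Fin m)) (χ : EuclideanSpace ℂ (Fin n)) :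
    ketbra (tensorVec φ χ) = ketbra φ.ofLp ⊗ₖ ketbra χ.ofLp := by
  ext p q
  simp only [ketbra, tensorVec, Matrix.vecMulVec_apply, Pi.star_apply, star_mul',
    Matrix.kroneckerMap_apply]
  ring

end BornRule

section Separable

variable {m n m' n' : ℕ}

theorem kronecker_sum {R l l' r r' ι : Type*} [CommSemiring R] (s : Finset ι)
    (F : Matrix l l' R) (G : ι → Matrix r r' R) : F ⊗ₖ (∑ i ∈ s, G i) = ∑ i ∈ s, F ⊗ₖ G i :=
  map_sum (Matrix.kroneckerBilinear (R := R) F) G s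

theorem sum_kronecker {R l l' r r' ι : Type*} [CommSemiring R] (s : Finset ι)
    (F : ι → Matrix l l' R) (G : Matrix r r' R) : (∑ i ∈ s, F i) ⊗ₖ G = ∑ i ∈ s, F i ⊗ₖ G :=
  LinearMap.map_sum₂ (Matrix.kroneckerBilinear (R := R)) s F G

theorem IsSeparableOp.kronecker {F : Matrix (Fin m) (Fin m) ℂ} {G : Matrix (Fin n) (Fin n) ℂ}
    (hF : F.PosSemidef) (hG : G.PosSemidef) : IsSeparableOp (F ⊗ₖ G) :=
  ⟨1, fun _ => F, fun _ => G, fun _ => hF, fun _ => hG, by simp⟩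

theorem IsSeparableOp.zero : IsSeparableOp (0 : BiOp m n) :=
  ⟨0, Fin.elim0, Fin.elim0, fun i => i.elim0, fun i => i.elim0, by simp⟩

theorem IsSeparableOp.one : IsSeparableOp (1 : BiOp m n) := by
  rw [← Matrix.one_kronecker_one]
  exact .kronecker .one .one

theorem IsSeparableOp.add {E E' : BiOp m n} (h : IsSeparableOp E) (h' : IsSeparableOp E') :
    IsSeparableOp (E + E') := by
  obtain ⟨k, F, G, hF, hG, rfl⟩ := h
  obtain ⟨k', F', G', hF', hG', rfl⟩ := h'
  refine ⟨k + k', Fin.append F F', Fin.append G G', fun i => ?_, fun i => ?_, ?_⟩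
  · refine Fin.addCases (fun j => ?_) (fun j => ?_) i <;> simp [hF, hF']
  · refine Fin.addCases (fun j => ?_) (fun j => ?_) i <;> simp [hG, hG']
  · simp [Fin.sum_univ_add]

theorem IsSeparableOp.sum {ι : Type*} (s : Finset ι) {E : ι → BiOp m n}
    (h : ∀ i ∈ s, IsSeparableOp (E i)) : IsSeparableOp (∑ i ∈ s, E i) :=
  Finset.sum_induction E IsSeparableOp (fun _ _ => .add) .zero h

theorem IsSeparableOp.posSemidef {E : BiOp m n} (h : IsSeparableOp E) : E.PosSemidef := by
  obtain ⟨k, F, G, hF, hG, rfl⟩ := h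
  exact Matrix.posSemidef_sum _ fun i _ => (hF i).kronecker (hG i)

theorem IsSeparableOp.conj {E : BiOp m' n'} (h : IsSeparableOp E)
    (A : Matrix (Fin m') (Fin m) ℂ) (B : Matrix (Fin n') (Fin n) ℂ) :
    IsSeparableOp ((A ⊗ₖ B)ᴴ * E * (A ⊗ₖ B)) := by
  obtain ⟨k, F, G, hF, hG, rfl⟩ := h
  rw [Matrix.mul_sum, Matrix.sum_mul]
  refine .sum _ fun i _ => ?_
  rw [Matrix.conjTranspose_kronecker, ← Matrix.mul_kronecker_mul, ← Matrix.mul_kronecker_mul]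
  exact .kronecker ((hF i).conjTranspose_mul_mul_same A) ((hG i).conjTranspose_mul_mul_same B)

theorem exists_eq_sum_ketbra {F : Matrix (Fin m) (Fin m) ℂ} (hF : F.PosSemidef) :
    ∃ (k : ℕ) (φ : Fin k → EuclideanSpace ℂ (Fin m)), F = ∑ i, ketbra (φ i).ofLp := by
  obtain ⟨k, v, rfl⟩ := Matrix.posSemidef_iff_eq_sum_vecMulVec.1 hF
  exact ⟨k, fun i => WithLp.toLp 2 (v i), rfl⟩

@[elab_as_elim]
theorem IsSeparableOp.ketbra_induction {P : BiOp m n → Prop} (zero : P 0)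
    (add : ∀ E E', P E → P E' → P (E + E')) (ketbra : ∀ φ χ, P (ketbra (tensorVec φ χ)))
    {E : BiOp m n} (hE : IsSeparableOp E) : P E := by
  obtain ⟨k, F, G, hF, hG, rfl⟩ := hE
  refine Finset.sum_induction _ P add zero fun i _ => ?_
  obtain ⟨r, φ, hφ⟩ := exists_eq_sum_ketbra (hF i)
  obtain ⟨s, χ, hχ⟩ := exists_eq_sum_ketbra (hG i)
  rw [hφ, hχ, sum_kronecker]
  refine Finset.sum_induction _ P add zero fun j _ => ?_
  rw [kronecker_sum]
  refine Finset.sum_induction _ P add zero fun l _ => ?_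
  rw [← ketbra_tensorVec]
  exact ketbra (φ j) (χ l)

theorem isSeparableMeasurement_iff {M : Answer → BiOp m n} :
    IsSeparableMeasurement M ↔ (∀ a, IsSeparableOp (M a)) ∧ ∑ a, M a = 1 :=
  ⟨fun h => ⟨h.2, h.1.sum_eq_one⟩, fun h => ⟨⟨fun a => (h.1 a).posSemidef, h.2⟩, h.1⟩⟩

theorem isSeparableMeasurement_announce (b : Answer) :
    IsSeparableMeasurement fun a => if a = b then (1 : BiOp m n) else 0 := by
  refine isSeparableMeasurement_iff.2 ⟨fun a => ?_, by simp⟩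
  split_ifs
  exacts [.one, .zero]

theorem IsSeparableMeasurement.sum_conj {ι : Type*} [Fintype ι]
    {A : ι → Matrix (Fin m') (Fin m) ℂ} {B : ι → Matrix (Fin n') (Fin n) ℂ}
    (hAB : ∑ i, ((A i)ᴴ * A i) ⊗ₖ ((B i)ᴴ * B i) = 1) {N : ι → Answer → BiOp m' n'}
    (hN : ∀ i, IsSeparableMeasurement (N i)) :
    IsSeparableMeasurement fun a => ∑ i, (A i ⊗ₖ B i)ᴴ * N i a * (A i ⊗ₖ B i) := by
  refine isSeparableMeasurement_iff.2 ⟨fun a => .sum _ fun i _ => ((hN i).2 a).conj _ _, ?_⟩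
  rw [Finset.sum_comm, ← hAB]
  refine Finset.sum_congr rfl fun i _ => ?_
  rw [← Matrix.sum_mul, ← Matrix.mul_sum, (hN i).1.sum_eq_one, Matrix.mul_one,
    Matrix.conjTranspose_kronecker, ← Matrix.mul_kronecker_mul]

theorem IsLOCC.isSeparableMeasurement {M : Answer → BiOp m n} (h : IsLOCC M) :
    IsSeparableMeasurement M := by
  induction h with
  | announce b => exact isSeparableMeasurement_announce b
  | left K hK N _ ih =>
    refine .sum_conj ?_ ih
    rw [← sum_kronecker, hK, Matrix.conjTranspose_one, Matrix.mul_one, Matrix.one_kronecker_one]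
  | right K hK N _ ih =>
    refine .sum_conj ?_ ih
    rw [← kronecker_sum, hK, Matrix.conjTranspose_one, Matrix.mul_one, Matrix.one_kronecker_one]

end Separable

section Payoff

theorem sum_answer {β : Type*} [AddCommMonoid β] (f : Answer → β) :
    ∑ a, f a = f .same + f .different + f .dontKnow := by
  change ∑ a ∈ ({.same, .different, .dontKnow} : Finset Answer), f a = _
  simp [add_assoc]

theorem payoff_le_one {c : ℝ} (hc : -1 ≤ c) (x y : Fin 2) (a : Answer) : payoff c x y a ≤ 1 := by
  cases a <;> simp only [payoff] <;> (try split_ifs) <;> linarith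

variable {d : ℕ}

theorem expectedPayoff_eq_sum_answer (c : ℝ) (ψ : Fin 2 → EuclideanSpace ℂ (Fin d))
    (M : Answer → BiOp d d) :
    expectedPayoff c ψ M =
      1 / 4 * ∑ a, ∑ x, ∑ y, payoff c x y a * bornProb (M a) (tensorVec (ψ x) (ψ y)) := by
  simp only [expectedPayoff, sum_answer, Fin.sum_univ_two]
  ring

theorem expectedPayoff_le_one {c : ℝ} (hc : -1 ≤ c) {ψ : Fin 2 → EuclideanSpace ℂ (Fin d)}
    (hψ : ∀ x, ‖ψ x‖ = 1) {M : Answer → BiOp d d} (hM : IsMeasurement M) :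
    expectedPayoff c ψ M ≤ 1 := by
  have conditional_le_one (x y : Fin 2) :
      ∑ a, payoff c x y a * bornProb (M a) (tensorVec (ψ x) (ψ y)) ≤ 1 :=
    calc ∑ a, payoff c x y a * bornProb (M a) (tensorVec (ψ x) (ψ y))
        ≤ ∑ a, bornProb (M a) (tensorVec (ψ x) (ψ y)) :=
          Finset.sum_le_sum fun a _ => mul_le_of_le_one_left
            (bornProb_nonneg (hM.posSemidef a) _) (payoff_le_one hc x y a)
      _ = 1 := by simp [hM.sum_bornProb, bornProb_one_tensorVec, hψ]
  calc expectedPayoff c ψ M ≤ ∑ _x : Fin 2, ∑ _y : Fin 2, (1 / 4 : ℝ) * 1 := by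
        unfold expectedPayoff
        gcongr
        exact conditional_le_one _ _
    _ = 1 := by norm_num

theorem expectedPayoff_eq_of_unambiguous (c : ℝ) {ψ : Fin 2 → EuclideanSpace ℂ (Fin d)}
    {M : Answer → BiOp d d} {p : ℝ}
    (same : ∀ x y, bornProb (M .same) (tensorVec (ψ x) (ψ y)) = if x = y then p else 0)
    (different : ∀ x y, bornProb (M .different) (tensorVec (ψ x) (ψ y)) = if x = y then 0 else p) :
    expectedPayoff c ψ M = p := by
  simp only [expectedPayoff, sum_answer, payoff, same, different, Fin.sum_univ_two, Fin.isValue,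
    if_true, zero_ne_one, one_ne_zero, if_false]
  ring

theorem expectedPayoff_smul_of_norm_eq_one (c : ℝ) (ψ : Fin 2 → EuclideanSpace ℂ (Fin d))
    {ω : Fin 2 → ℂ} (hω : ∀ x, ‖ω x‖ = 1) :
    expectedPayoff c (fun x => ω x • ψ x) = expectedPayoff c ψ := by
  have tensorVec_smul (x y : Fin 2) :
      tensorVec (ω x • ψ x) (ω y • ψ y) = (ω x * ω y) • tensorVec (ψ x) (ψ y) := by
    ext p
    simp only [tensorVec, PiLp.smul_apply, Pi.smul_apply, smul_eq_mul]
    ring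
  ext M
  simp [expectedPayoff, tensorVec_smul, bornProb_smul_vec, hω]

theorem exists_phases_inner_eq_norm {E : Type*} [SeminormedAddCommGroup E]
    [InnerProductSpace ℂ E] (ψ : Fin 2 → E) :
    ∃ ω : Fin 2 → ℂ, (∀ x, ‖ω x‖ = 1) ∧
      inner ℂ (ω 0 • ψ 0) (ω 1 • ψ 1) = (‖inner ℂ (ψ 0) (ψ 1)‖ : ℂ) := by
  obtain ⟨z, hz, hnorm⟩ := Complex.exists_norm_eq_mul_self (inner ℂ (ψ 0) (ψ 1))
  refine ⟨![1, z], fun x => ?_, ?_⟩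
  · fin_cases x <;> simp [hz]
  · simp [hnorm, inner_smul_right]

theorem bddAbove_expectedPayoff {c : ℝ} (hc : -1 ≤ c) {ψ : Fin 2 → EuclideanSpace ℂ (Fin d)}
    (hψ : ∀ x, ‖ψ x‖ = 1) : BddAbove (expectedPayoff c ψ '' {M | IsMeasurement M}) :=
  ⟨1, Set.forall_mem_image.2 fun _ hM => expectedPayoff_le_one hc hψ hM⟩

theorem loccPayoff_le_sepPayoff {c : ℝ} (hc : -1 ≤ c) {ψ : Fin 2 → EuclideanSpace ℂ (Fin d)}
    (hψ : ∀ x, ‖ψ x‖ = 1) : loccPayoff c ψ ≤ sepPayoff c ψ :=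
  csSup_le_csSup ((bddAbove_expectedPayoff hc hψ).mono (Set.image_mono fun _ h => h.1))
    (Set.Nonempty.image _ ⟨_, IsLOCC.announce .dontKnow⟩)
    (Set.image_mono fun _ h => h.isSeparableMeasurement)

end Payoff

section SeparableBound

variable {d : ℕ}

theorem sum_payoff_mul_norm_sq_le {η : ℝ} (hη : 0 < η) (α β : Fin 2 → ℂ) (a : Answer) :
    ∑ x, ∑ y, payoff (3 + 2 / η) x y a * ‖α x * β y‖ ^ 2 ≤
      (1 + η) * ‖(α 0 - α 1) * (β 0 - β 1)‖ ^ 2 := by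
  have products_eq : ‖α 0 * β 0‖ * ‖α 1 * β 1‖ = ‖α 0 * β 1‖ * ‖α 1 * β 0‖ := by
    simp only [norm_mul]
    ring
  have diagonal_sub : (α 0 - α 1) * (β 0 - β 1) =
      α 0 * β 0 + α 1 * β 1 - (α 0 * β 1 + α 1 * β 0) := by ring
  cases a with
  | same =>
    simp only [payoff, Fin.sum_univ_two, Fin.isValue, if_true, zero_ne_one, one_ne_zero, if_false]
    rw [diagonal_sub]
    linarith [norm_sq_add_norm_sq_sub_le_of_norm_mul_eq hη products_eq]
  | different =>
    simp only [payoff, Fin.sum_univ_two, Fin.isValue, if_true, zero_ne_one, one_ne_zero, if_false]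
    rw [diagonal_sub, norm_sub_rev]
    linarith [norm_sq_add_norm_sq_sub_le_of_norm_mul_eq hη products_eq.symm]
  | dontKnow =>
    simp only [payoff, zero_mul, Finset.sum_const_zero]
    positivity

theorem IsSeparableOp.sum_payoff_mul_bornProb_le {η : ℝ} (hη : 0 < η)
    (ψ : Fin 2 → EuclideanSpace ℂ (Fin d)) (a : Answer) {E : BiOp d d} (hE : IsSeparableOp E) :
    ∑ x, ∑ y, payoff (3 + 2 / η) x y a * bornProb E (tensorVec (ψ x) (ψ y)) ≤
      (1 + η) * bornProb E (tensorVec (ψ 0 - ψ 1) (ψ 0 - ψ 1)) := by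
  refine IsSeparableOp.ketbra_induction ?zero (fun E E' hE hE' => ?add) (fun φ χ => ?ketbra) hE
  case zero => simp [bornProb]
  case add =>
    simp only [bornProb_add, mul_add, Finset.sum_add_distrib]
    exact add_le_add hE hE'
  case ketbra =>
    simp only [bornProb_ketbra, star_tensorVec_dotProduct_tensorVec, inner_sub_right]
    exact sum_payoff_mul_norm_sq_le hη (fun x => inner ℂ φ (ψ x)) (fun y => inner ℂ χ (ψ y)) a

theorem IsSeparableMeasurement.expectedPayoff_le {η : ℝ} (hη : 0 < η)
    (ψ : Fin 2 → EuclideanSpace ℂ (Fin d)) {M : Answer → BiOp d d}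
    (hM : IsSeparableMeasurement M) :
    expectedPayoff (3 + 2 / η) ψ M ≤ (1 + η) * (‖ψ 0 - ψ 1‖ ^ 2 / 2) ^ 2 :=
  calc expectedPayoff (3 + 2 / η) ψ M
      ≤ 1 / 4 * ∑ a, (1 + η) * bornProb (M a) (tensorVec (ψ 0 - ψ 1) (ψ 0 - ψ 1)) := by
        rw [expectedPayoff_eq_sum_answer]
        gcongr with a
        exact (hM.2 a).sum_payoff_mul_bornProb_le hη ψ a
    _ = (1 + η) * (‖ψ 0 - ψ 1‖ ^ 2 / 2) ^ 2 := by
        rw [← Finset.mul_sum, hM.1.sum_bornProb, bornProb_one_tensorVec]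
        ring

theorem norm_sub_sq_of_inner_eq_ofReal {E : Type*} [SeminormedAddCommGroup E]
    [InnerProductSpace ℂ E] {τ : ℝ} {φ χ : E} (hφ : ‖φ‖ = 1) (hχ : ‖χ‖ = 1)
    (h : inner ℂ φ χ = (τ : ℂ)) : ‖φ - χ‖ ^ 2 = 2 * (1 - τ) := by
  rw [norm_sub_sq (𝕜 := ℂ), hφ, hχ, h, RCLike.re_to_complex, Complex.ofReal_re]
  ring

theorem sepPayoff_le {η : ℝ} (hη : 0 < η) {ψ : Fin 2 → EuclideanSpace ℂ (Fin d)}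
    (hψ : ∀ x, ‖ψ x‖ = 1) :
    sepPayoff (3 + 2 / η) ψ ≤ (1 + η) * (1 - ‖inner ℂ (ψ 0) (ψ 1)‖) ^ 2 := by
  obtain ⟨ω, hω, hinner⟩ := exists_phases_inner_eq_norm ψ
  have norm_eq_one (x : Fin 2) : ‖ω x • ψ x‖ = 1 := by rw [norm_smul, hω, hψ, one_mul]
  refine csSup_le (Set.Nonempty.image _ ⟨_, isSeparableMeasurement_announce .dontKnow⟩)
    (Set.forall_mem_image.2 fun M hM => ?_)
  have bound := hM.expectedPayoff_le hη fun x => ω x • ψ x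
  rwa [expectedPayoff_smul_of_norm_eq_one _ _ hω,
    norm_sub_sq_of_inner_eq_ofReal (norm_eq_one 0) (norm_eq_one 1) hinner,
    mul_div_cancel_left₀ _ two_ne_zero] at bound

end SeparableBound

section UnambiguousComparison

variable {d : ℕ}

/-- The element of the answer "same" (`σ = 1`) or "different" (`σ = -1`) in the measurement
`unambiguousMeasurement e κ`. -/
noncomputable def conclusiveElement (e : Fin 2 → EuclideanSpace ℂ (Fin d)) (κ σ : ℝ) : BiOp d d :=
  (1 / 2 : ℝ) • (ketbra (tensorVec (e 0) (e 1) + (σ : ℂ) • tensorVec (e 1) (e 0)) +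
    ketbra ((κ : ℂ) • tensorVec (e 0) (e 0) + (σ : ℂ) • tensorVec (e 1) (e 1)))

/-- The measurement that compares two states drawn from `C e₀ + S e₁` and `C e₀ - S e₁` without
ever giving a wrong answer, for orthonormal `e₀`, `e₁` and `κ = S² / C²`. -/
noncomputable def unambiguousMeasurement (e : Fin 2 → EuclideanSpace ℂ (Fin d)) (κ : ℝ) :
    Answer → BiOp d d
  | .same => conclusiveElement e κ 1
  | .different => conclusiveElement e κ (-1)
  | .dontKnow => 1 - (conclusiveElement e κ 1 + conclusiveElement e κ (-1))

theorem posSemidef_conclusiveElement (e : Fin 2 → EuclideanSpace ℂ (Fin d)) (κ σ : ℝ) :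
    (conclusiveElement e κ σ).PosSemidef :=
  ((posSemidef_ketbra _).add (posSemidef_ketbra _)).smul (by norm_num)

theorem conclusiveElement_one_add_conclusiveElement_neg_one
    (e : Fin 2 → EuclideanSpace ℂ (Fin d)) (κ : ℝ) :
    conclusiveElement e κ 1 + conclusiveElement e κ (-1) =
      ∑ p : Fin 2 × Fin 2, (if p = 0 then κ ^ 2 else 1) • ketbra (tensorVec (e p.1) (e p.2)) := by
  simp only [conclusiveElement, Complex.ofReal_one, Complex.ofReal_neg, one_smul, neg_smul,
    ← sub_eq_add_neg]
  rw [← smul_add, add_add_add_comm, ketbra_add_add_ketbra_sub, ketbra_add_add_ketbra_sub,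
    ketbra_smul]
  simp only [Fintype.sum_prod_type, Fin.sum_univ_two, Prod.mk_eq_zero, one_ne_zero, and_true,
    and_false, if_true, if_false]
  module

theorem isMeasurement_unambiguousMeasurement {e : Fin 2 → EuclideanSpace ℂ (Fin d)}
    (he : Orthonormal ℂ e) {κ : ℝ} (hκ : κ ^ 2 ≤ 1) :
    IsMeasurement (unambiguousMeasurement e κ) where
  posSemidef
    | .same => posSemidef_conclusiveElement e κ 1
    | .different => posSemidef_conclusiveElement e κ (-1)
    | .dontKnow => by
      rw [unambiguousMeasurement, conclusiveElement_one_add_conclusiveElement_neg_one]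
      refine posSemidef_one_sub_sum_smul_ketbra (orthonormal_tensorVec he he) fun p => ?_
      split_ifs
      exacts [hκ, le_rfl]
  sum_eq_one := by
    rw [sum_answer]
    exact add_sub_cancel _ _

theorem bornProb_conclusiveElement (e : Fin 2 → EuclideanSpace ℂ (Fin d)) (κ σ : ℝ)
    {φ χ : EuclideanSpace ℂ (Fin d)} {p q r s : ℝ} (hp : inner ℂ (e 0) φ = (p : ℂ))
    (hq : inner ℂ (e 1) φ = (q : ℂ)) (hr : inner ℂ (e 0) χ = (r : ℂ))
    (hs : inner ℂ (e 1) χ = (s : ℂ)) :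
    bornProb (conclusiveElement e κ σ) (tensorVec φ χ) =
      1 / 2 * ((p * s + σ * (q * r)) ^ 2 + (κ * (p * r) + σ * (q * s)) ^ 2) := by
  rw [conclusiveElement, bornProb_smul, bornProb_add, bornProb_ketbra, bornProb_ketbra]
  simp only [star_add, star_smul, add_dotProduct, smul_dotProduct,
    star_tensorVec_dotProduct_tensorVec, hp, hq, hr, hs, smul_eq_mul, Complex.star_def,
    Complex.conj_ofReal]
  norm_cast
  simp only [Real.norm_eq_abs, sq_abs]

theorem expectedPayoff_unambiguousMeasurement (c : ℝ) {e ψ : Fin 2 → EuclideanSpace ℂ (Fin d)}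
    {C S : ℝ} (hC : C ≠ 0) (hCS : C ^ 2 + S ^ 2 = 1) (h0 : ∀ x, inner ℂ (e 0) (ψ x) = (C : ℂ))
    (h1 : ∀ x, inner ℂ (e 1) (ψ x) = (((-1) ^ (x : ℕ) * S : ℝ) : ℂ)) :
    expectedPayoff c ψ (unambiguousMeasurement e (S ^ 2 / C ^ 2)) = 2 * S ^ 2 := by
  have cancel : S ^ 2 / C ^ 2 * (C * C) = S ^ 2 := by field_simp
  have prob (σ : ℝ) (x y : Fin 2) :
      bornProb (conclusiveElement e (S ^ 2 / C ^ 2) σ) (tensorVec (ψ x) (ψ y)) =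
        S ^ 2 * (1 + σ * (-1) ^ (x + y : ℕ)) ^ 2 / 2 := by
    have sign_sq : ((-1 : ℝ) ^ (y : ℕ)) ^ 2 = 1 := by rw [← pow_mul', pow_mul, neg_one_sq, one_pow]
    rw [bornProb_conclusiveElement e _ σ (h0 x) (h1 x) (h0 y) (h1 y), cancel, pow_add]
    linear_combination C ^ 2 * S ^ 2 / 2 * (1 - σ ^ 2 * ((-1) ^ (x : ℕ)) ^ 2) * sign_sq +
      S ^ 2 / 2 * (1 + σ * ((-1) ^ (x : ℕ) * (-1) ^ (y : ℕ))) ^ 2 * hCS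
  refine expectedPayoff_eq_of_unambiguous c (fun x y => ?_) (fun x y => ?_)
  · rw [unambiguousMeasurement, prob]
    fin_cases x <;> fin_cases y <;> norm_num <;> ring
  · rw [unambiguousMeasurement, prob]
    fin_cases x <;> fin_cases y <;> norm_num <;> ring

theorem inner_add_sub_eq_zero {E : Type*} [SeminormedAddCommGroup E] [InnerProductSpace ℂ E]
    {τ : ℝ} {φ χ : E} (hnorm : ‖φ‖ = ‖χ‖) (h : inner ℂ φ χ = (τ : ℂ)) :
    inner ℂ (φ + χ) (φ - χ) = 0 := by
  have h' : inner ℂ χ φ = (τ : ℂ) := by rw [← inner_conj_symm, h, Complex.conj_ofReal]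
  simp only [inner_add_left, inner_sub_right, inner_self_eq_norm_sq_to_K, h, h', hnorm]
  ring

theorem exists_orthonormal_inner_eq {E : Type*} [NormedAddCommGroup E] [InnerProductSpace ℂ E]
    {ψ : Fin 2 → E} (hadd : ψ 0 + ψ 1 ≠ 0) (hsub : ψ 0 - ψ 1 ≠ 0)
    (horth : inner ℂ (ψ 0 + ψ 1) (ψ 0 - ψ 1) = 0) :
    ∃ e : Fin 2 → E, Orthonormal ℂ e ∧
      (∀ x, inner ℂ (e 0) (ψ x) = ((‖ψ 0 + ψ 1‖ / 2 : ℝ) : ℂ)) ∧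
      ∀ x, inner ℂ (e 1) (ψ x) = (((-1) ^ (x : ℕ) * (‖ψ 0 - ψ 1‖ / 2) : ℝ) : ℂ) := by
  have decomp : ∀ x : Fin 2,
      ψ x = (1 / 2 : ℂ) • ((ψ 0 + ψ 1) + ((-1) ^ (x : ℕ) : ℂ) • (ψ 0 - ψ 1)) :=
    Fin.forall_fin_two.2 ⟨by rw [Fin.val_zero]; module, by rw [Fin.val_one]; module⟩
  set s := ψ 0 + ψ 1
  set t := ψ 0 - ψ 1
  have horth' : inner ℂ t s = 0 := inner_eq_zero_symm.1 horth
  have hs : (‖s‖ : ℂ) ≠ 0 := by exact_mod_cast norm_ne_zero_iff.2 hadd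
  have ht : (‖t‖ : ℂ) ≠ 0 := by exact_mod_cast norm_ne_zero_iff.2 hsub
  refine ⟨![(‖s‖⁻¹ : ℂ) • s, (‖t‖⁻¹ : ℂ) • t], ?_, fun x => ?_, fun x => ?_⟩
  · rw [orthonormal_vecCons_iff]
    refine ⟨norm_smul_inv_norm hadd, fun i => ?_,
      orthonormal_vecCons_iff.2 ⟨norm_smul_inv_norm hsub, by simp⟩⟩
    fin_cases i
    simp [horth]
  · rw [decomp x]
    simp only [Matrix.cons_val_zero, inner_smul_left, inner_smul_right, inner_add_right, horth,
      inner_self_eq_norm_sq_to_K, map_inv₀, Complex.conj_ofReal, mul_zero, add_zero,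
      Complex.coe_algebraMap]
    push_cast
    field_simp
  · rw [decomp x]
    simp only [Matrix.cons_val_one, Matrix.cons_val_fin_one, inner_smul_left, inner_smul_right,
      inner_add_right, horth', inner_self_eq_norm_sq_to_K, map_inv₀, Complex.conj_ofReal,
      mul_zero, zero_add, Complex.coe_algebraMap]
    push_cast
    field_simp

theorem norm_add_sq_of_inner_eq_ofReal {E : Type*} [SeminormedAddCommGroup E]
    [InnerProductSpace ℂ E] {τ : ℝ} {φ χ : E} (hφ : ‖φ‖ = 1) (hχ : ‖χ‖ = 1)
    (h : inner ℂ φ χ = (τ : ℂ)) : ‖φ + χ‖ ^ 2 = 2 * (1 + τ) := by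
  rw [norm_add_sq (𝕜 := ℂ), hφ, hχ, h, RCLike.re_to_complex, Complex.ofReal_re]
  ring

theorem exists_isMeasurement_expectedPayoff_eq (c : ℝ) {τ : ℝ} (hτ₀ : 0 ≤ τ) (hτ₁ : τ < 1)
    {ψ : Fin 2 → EuclideanSpace ℂ (Fin d)} (hψ : ∀ x, ‖ψ x‖ = 1)
    (hinner : inner ℂ (ψ 0) (ψ 1) = (τ : ℂ)) :
    ∃ M : Answer → BiOp d d, IsMeasurement M ∧ expectedPayoff c ψ M = 1 - τ := by
  have hadd := norm_add_sq_of_inner_eq_ofReal (hψ 0) (hψ 1) hinner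
  have hsub := norm_sub_sq_of_inner_eq_ofReal (hψ 0) (hψ 1) hinner
  have hadd_pos : 0 < ‖ψ 0 + ψ 1‖ := by
    refine (norm_nonneg _).lt_of_ne' fun h => ?_
    rw [h] at hadd
    linarith
  have hsub_pos : 0 < ‖ψ 0 - ψ 1‖ := by
    refine (norm_nonneg _).lt_of_ne' fun h => ?_
    rw [h] at hsub
    linarith
  obtain ⟨e, he, h0, h1⟩ := exists_orthonormal_inner_eq (norm_pos_iff.1 hadd_pos)
    (norm_pos_iff.1 hsub_pos) (inner_add_sub_eq_zero ((hψ 0).trans (hψ 1).symm) hinner)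
  refine ⟨_, isMeasurement_unambiguousMeasurement he (pow_le_one₀ ?_ ?_),
    (expectedPayoff_unambiguousMeasurement c ?_ ?_ h0 h1).trans ?_⟩
  · positivity
  · rw [div_le_one (by positivity)]
    linarith
  · positivity
  · linarith
  · linarith

theorem one_sub_norm_inner_le_maxPayoff {c : ℝ} (hc : -1 ≤ c)
    {ψ : Fin 2 → EuclideanSpace ℂ (Fin d)} (hψ : ∀ x, ‖ψ x‖ = 1)
    (hlt : ‖inner ℂ (ψ 0) (ψ 1)‖ < 1) : 1 - ‖inner ℂ (ψ 0) (ψ 1)‖ ≤ maxPayoff c ψ := by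
  obtain ⟨ω, hω, hinner⟩ := exists_phases_inner_eq_norm ψ
  have norm_eq_one (x : Fin 2) : ‖ω x • ψ x‖ = 1 := by rw [norm_smul, hω, hψ, one_mul]
  obtain ⟨M, hM, hpayoff⟩ :=
    exists_isMeasurement_expectedPayoff_eq c (norm_nonneg _) hlt norm_eq_one hinner
  rw [expectedPayoff_smul_of_norm_eq_one _ _ hω] at hpayoff
  exact hpayoff ▸ le_csSup (bddAbove_expectedPayoff hc hψ) ⟨M, hM, rfl⟩

end UnambiguousComparison

theorem gap_pos {τ : ℝ} (hτ₀ : 0 < τ) (hτ₁ : τ < 1) : 0 < gap τ := by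
  have : 0 < 1 - τ := sub_pos.2 hτ₁
  unfold gap
  positivity

end StateComparison

theorem mainTheorem1 (τ : ℝ) (hτ₀ : 0 < τ) (hτ₁ : τ < 1) :
    0 < StateComparison.gap τ ∧
    ∃ c : ℝ, 0 < c ∧
      ∀ (d : ℕ) (ψ : Fin 2 → EuclideanSpace ℂ (Fin d)),
        (∀ x, ‖ψ x‖ = 1) → ‖inner ℂ (ψ 0) (ψ 1)‖ = τ →
          StateComparison.sepPayoff c ψ ≤
            StateComparison.maxPayoff c ψ - StateComparison.gap τ ∧
          StateComparison.loccPayoff c ψ ≤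
            StateComparison.maxPayoff c ψ - StateComparison.gap τ ∧
          StateComparison.sepPayoff c ψ ≤ (1 - τ) - StateComparison.gap τ ∧
          1 - τ ≤ StateComparison.maxPayoff c ψ := by
  have one_sub_pos : 0 < 1 - τ := sub_pos.2 hτ₁
  -- The value of `η` for which `(1 + η) * (1 - τ) ^ 2 = (1 - τ) - gap τ`.
  let η : ℝ := 9 * τ / (10 * (1 - τ))
  have η_pos : 0 < η := by positivity
  have bound_eq : (1 + η) * (1 - τ) ^ 2 = (1 - τ) - StateComparison.gap τ := by
    simp only [η, StateComparison.gap]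
    field_simp
    ring
  have c_pos : 0 < 3 + 2 / η := by positivity
  refine ⟨StateComparison.gap_pos hτ₀ hτ₁, 3 + 2 / η, c_pos, fun d ψ hψ hinner => ?_⟩
  have sep_le := StateComparison.sepPayoff_le η_pos hψ
  rw [hinner, bound_eq] at sep_le
  have le_max := StateComparison.one_sub_norm_inner_le_maxPayoff (c := 3 + 2 / η) (by linarith) hψ
    (hinner.trans_lt hτ₁)
  rw [hinner] at le_max
  have locc_le_sep := StateComparison.loccPayoff_le_sepPayoff (c := 3 + 2 / η) (by linarith) hψ
  exact ⟨by linarith, by linarith, sep_le, le_max⟩
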